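/- Let $X$ be a Banach space and let $A\subseteq X\times X$ be an $m$-accretive operator of type $\omega\ge 0$, i.e. for every $\lambda>0$ with $\lambda\omega<1$ one has $\|x-\hat x+\lambda(f-\hat f)\|\ge(1-\lambda\omega)\|x-\hat x\|$ for all $(x,f),(\hat x,\hat f)\in A$, and $I+\lambda A$ is surjective onto $X$. Let $S$ be the nonlinear semigroup generated by $-A$ on $\overline{\operatorname{dom}A}$: for $x\in\overline{\operatorname{dom}A}$, $S(\cdot)x$ is the mild solution on $[0,\infty)$ of $\dot u+Au\ni 0$, $u(0)=x$. Let $\mathrm E$ be a Banach function space over $(0,\infty)$, i.e. a Banach space of classes of complex measurable functions with $L^1\cap L^\infty(0,\infty)\subseteq \mathrm E\subseteq L^1+L^\infty(0,\infty)$ that is an order ideal of $L^1+L^\infty(0,\infty)$ with $\|g\|_{\mathrm E}\le\|f\|_{\mathrm E}$ whenever $|g|\le|f|$, $f\in\mathrm E$. Assume that the Hardy operator $Pf(t)=\frac1t\int_0^tf(s)\,ds$ is bounded on $\mathrm E$. For functions $\mathcal N_0,\mathcal N_1$ on a vector space $Y$ with values in $[0,\infty]$ put $$K(y,t)=\inf_{v\in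 Y}\big(\mathcal N_0(y-v)+t\,\mathcal N_1(v)\big),\qquad t>0.$$ Let $K^A$ be the $K$-function of the couple $\mathcal N^A=(\|\cdot\|,|A\cdot|)$ on $X$, where $|Ax|=\inf\{\|f\| : (x,f)\in A\}$ and $\inf\emptyset=\infty$, and for $\tau>0$ let $(\mathcal N^A)^\tau_{\mathrm E}(x)=\big\|t\mapsto \tfrac{K^A(x,t)}{t}\chi_{(0,\tau)}(t)\big\|_{\mathrm E}$, which is $+\infty$ if this function is not in $\mathrm E$. Let $\tau>0$ and let $x\in X$ be such that $(\mathcal N^A)^\tau_{\mathrm E}(x)<\infty$. Then $x\in\overline{\operatorname{dom}A}$, and for every $T\ge 0$, $$S(\cdot)x\in\big(C([0,T];X),\operatorname{Lip}([0,T];X)\big)_{\mathrm E},$$ where the space on the right is the set of all $u\in C([0,T];X)$ for which $t\mapsto K(u,t)/t$ belongs to $\mathrm E$, with $K$ the $K$-function of the couple consisting of the supremum norm $\|\cdot\|_\infty$ and the Lipschitz norm $\|g\|_\infty+[g]_{\operatorname{Lip}}$ on $C([0,T];X)$; here $[g]_{\operatorname{Lip}}\in[0,\infty]$ is the least Lipschitz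 constant of $g$. Moreover, for every $t>0$, $$\inf\big\{\|S(\cdot)x-g\|_\infty+t\,[g]_{\operatorname{Lip}} : g\in \operatorname{Lip}([0,T];X)\big\}\le e^{\omega T}K^A(x,t).$$ -/

import Mathlib

open MeasureTheory Set
open scoped ENNReal NNReal

noncomputable section

namespace RealInterp

/-- Lebesgue measure on `(0,∞)`. -/
abbrev halfLine : Measure ℝ := volume.restrict (Ioi (0 : ℝ))

/-- `f ∈ L¹ ∩ L^∞ (0,∞)`. -/
def MemInter (f : ℝ →ₘ[halfLine] ℂ) : Prop :=
  MemLp f 1 halfLine ∧ MemLp f ∞ halfLine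

/-- `f ∈ L¹ + L^∞ (0,∞)`. -/
def MemSum (f : ℝ →ₘ[halfLine] ℂ) : Prop :=
  ∃ g h : ℝ →ₘ[halfLine] ℂ, MemLp g 1 halfLine ∧ MemLp h ∞ halfLine ∧ f = g + h

/-- A Banach function space over `(0,∞)`: a Banach space `E` of (classes of) measurable functions
with `L¹ ∩ L^∞ ⊆ E ⊆ L¹ + L^∞` that is an order ideal of `L¹ + L^∞`, with monotone norm. -/
structure BanachFunctionSpace where
  /-- the vector space of functions -/
  carrier : Submodule ℂ (ℝ →ₘ[halfLine] ℂ)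
  /-- the norm of the space -/
  norm : Seminorm ℂ carrier
  eq_zero_of_norm_eq_zero : ∀ f : carrier, norm f = 0 → f = 0
  complete : ∀ u : ℕ → carrier,
    (∀ ε : ℝ, 0 < ε → ∃ N : ℕ, ∀ m ≥ N, ∀ n ≥ N, norm (u m - u n) < ε) →
    ∃ f : carrier, ∀ ε : ℝ, 0 < ε → ∃ N : ℕ, ∀ n ≥ N, norm (u n - f) < ε
  inter_subset : ∀ f : ℝ →ₘ[halfLine] ℂ, MemInter f → f ∈ carrier
  subset_sum : ∀ f ∈ carrier, MemSum f
  ideal : ∀ (f : carrier) (g : ℝ →ₘ[halfLine] ℂ), MemSum g →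
    (∀ᵐ t ∂halfLine, ‖g t‖ ≤ ‖(f : ℝ →ₘ[halfLine] ℂ) t‖) →
    ∃ hg : g ∈ carrier, norm ⟨g, hg⟩ ≤ norm f

/-- The Hardy operator `(P f)(t) = (1/t) ∫₀ᵗ f(s) ds`. -/
def hardy (f : ℝ → ℂ) (t : ℝ) : ℂ := (t : ℂ)⁻¹ * ∫ s in (0 : ℝ)..t, f s

/-- The Hardy operator is bounded on `E` (in particular, it maps `E` into `E`). -/
def BanachFunctionSpace.HardyBounded (E : BanachFunctionSpace) : Prop :=
  ∃ C : ℝ, ∀ f : E.carrier, ∃ g : E.carrier,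
    ((g : ℝ →ₘ[halfLine] ℂ) : ℝ → ℂ) =ᵐ[halfLine] hardy (f : ℝ →ₘ[halfLine] ℂ) ∧
    E.norm g ≤ C * E.norm f

/-- The `E`-norm of a function `(0,∞) → [0,∞]`; it is `∞` if the function is not (a.e. finite and)
in `E`. The infimum is over at most one element `f`, the class of `g`. -/
def BanachFunctionSpace.extNorm (E : BanachFunctionSpace) (g : ℝ → ℝ≥0∞) : ℝ≥0∞ :=
  ⨅ (f : E.carrier)
    (_ : ∀ᵐ t ∂halfLine, g t ≠ ∞ ∧ (f : ℝ →ₘ[halfLine] ℂ) t = (((g t).toReal : ℝ) : ℂ)),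
    ENNReal.ofReal (E.norm f)

section KMethod

variable {Y : Type*} [AddCommGroup Y]

/-- The `K`-function of the interpolation couple of functions `(N₀, N₁)`. -/
def kFun (N₀ N₁ : Y → ℝ≥0∞) (x : Y) (t : ℝ) : ℝ≥0∞ :=
  ⨅ v : Y, N₀ (x - v) + ENNReal.ofReal t * N₁ v

/-- The interpolation function `N_E` of the `K`-method. -/
def interpFun (E : BanachFunctionSpace) (N₀ N₁ : Y → ℝ≥0∞) (x : Y) : ℝ≥0∞ :=
  E.extNorm fun t => kFun N₀ N₁ x t / ENNReal.ofReal t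

/-- The truncated interpolation function `N_E^τ` of the `K`-method. -/
def truncInterpFun (E : BanachFunctionSpace) (τ : ℝ) (N₀ N₁ : Y → ℝ≥0∞) (x : Y) : ℝ≥0∞ :=
  E.extNorm ((Ioo (0 : ℝ) τ).indicator fun t => kFun N₀ N₁ x t / ENNReal.ofReal t)

end KMethod

/-- The effective domain of a function with values in `[0,∞]`. -/
def effDom {Y : Type*} (N : Y → ℝ≥0∞) : Set Y := {x | N x < ∞}

section Operators

variable {X : Type*} [NormedAddCommGroup X] [NormedSpace ℝ X]

/-- The domain of an operator (relation) `A ⊆ X × X`. -/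
def opDom (A : Set (X × X)) : Set X := {x | ∃ f, (x, f) ∈ A}

/-- The set norm `|A x| = inf {‖f‖ : (x, f) ∈ A}`, with `inf ∅ = ∞`. -/
def setNorm (A : Set (X × X)) (x : X) : ℝ≥0∞ := ⨅ (f : X) (_ : (x, f) ∈ A), ‖f‖ₑ

/-- `A` is accretive of type `ω`. -/
def IsAccretive (ω : ℝ) (A : Set (X × X)) : Prop :=
  ∀ p ∈ A, ∀ q ∈ A, ∀ r : ℝ, 0 < r → r * ω < 1 →
    (1 - r * ω) * ‖p.1 - q.1‖ ≤ ‖p.1 - q.1 + r • (p.2 - q.2)‖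

/-- `A` is `m`-accretive of type `ω`: accretive of type `ω`, with `I + r A` surjective for all
`r > 0` such that `r ω < 1`. -/
def IsMAccretive (ω : ℝ) (A : Set (X × X)) : Prop :=
  IsAccretive ω A ∧ ∀ r : ℝ, 0 < r → r * ω < 1 → ∀ y : X, ∃ p ∈ A, p.1 + r • p.2 = y

/-- An `ε`-approximate solution on `[0,T]` of `u' + A u ∋ 0`: a partition
`0 = s₀ < s₁ < ⋯ < s_N ≤ T` with `T - ε < s_N` and mesh less than `ε`, and values `v₀, …, v_N` with
`(v_{i+1} - v_i) / (s_{i+1} - s_i) + A v_{i+1} ∋ f_{i+1}`, where the errors `f_i` satisfy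
`∑ (s_{i+1} - s_i) ‖f_{i+1}‖ < ε`. -/
structure IsApproxSolution (A : Set (X × X)) (T ε : ℝ) (N : ℕ) (s : ℕ → ℝ) (v f : ℕ → X) :
    Prop where
  start : s 0 = 0
  step_pos : ∀ i < N, s i < s (i + 1)
  step_lt : ∀ i < N, s (i + 1) - s i < ε
  end_le : s N ≤ T
  lt_end : T - ε < s N
  error : ∑ i ∈ Finset.range N, (s (i + 1) - s i) * ‖f (i + 1)‖ < ε
  mem : ∀ i < N, (v (i + 1), f (i + 1) - (s (i + 1) - s i)⁻¹ • (v (i + 1) - v i)) ∈ A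

/-- `u` is a mild solution on `[0,∞)` of `u' + A u ∋ 0`, `u(0) = x`: it is continuous with
`u(0) = x`, and on every `[0,T]` and for every `ε > 0` it is `ε`-close to the step function (equal
to `v₀` at `0` and to `v_{i+1}` on `(s_i, s_{i+1}]`) of some `ε`-approximate solution. -/
def IsMildSolution (A : Set (X × X)) (x : X) (u : ℝ → X) : Prop :=
  ContinuousOn u (Ici 0) ∧ u 0 = x ∧
  ∀ T : ℝ, 0 < T → ∀ ε : ℝ, 0 < ε → ∃ (N : ℕ) (s : ℕ → ℝ) (v f : ℕ → X),
    IsApproxSolution A T ε N s v f ∧ ‖u 0 - v 0‖ ≤ ε ∧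
    ∀ i < N, ∀ t ∈ Ioc (s i) (s (i + 1)), ‖u t - v (i + 1)‖ ≤ ε

/-- `S` is the semigroup generated by `-A` on the closure of the domain of `A`: its orbits are the
mild solutions of `u' + A u ∋ 0`. Only the values `S t x` with `t ≥ 0` and `x` in the closure of
the domain of `A` matter. -/
def IsGeneratedSemigroup (A : Set (X × X)) (S : ℝ → X → X) : Prop :=
  ∀ x ∈ closure (opDom A), IsMildSolution A x fun t => S t x

/-- The Lipschitz seminorm (least Lipschitz constant) of a continuous function on `[0,T]`, equal
to `∞` if the function is not Lipschitz continuous. -/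
def lipSeminorm {T : ℝ} (g : C(Icc (0 : ℝ) T, X)) : ℝ≥0∞ :=
  ⨅ (L : ℝ≥0) (_ : LipschitzWith L g), (L : ℝ≥0∞)

/-- The norm of the Banach space `Lip([0,T];X)`, equal to `∞` outside of it. -/
def lipNorm {T : ℝ} (g : C(Icc (0 : ℝ) T, X)) : ℝ≥0∞ := ‖g‖ₑ + lipSeminorm g

/-- The real interpolation space `(C([0,T];X), Lip([0,T];X))_E`, as a subset of the sum space
`C([0,T];X) + Lip([0,T];X) = C([0,T];X)`. -/
def interpSpaceCLip (E : BanachFunctionSpace) (T : ℝ) (X : Type*) [NormedAddCommGroup X] :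
    Set C(Icc (0 : ℝ) T, X) :=
  effDom (interpFun E (fun g : C(Icc (0 : ℝ) T, X) => ‖g‖ₑ) lipNorm)

end Operators

end RealInterp

end

/-! An orbit is compared with orbits that start in the domain. If (v, f) ∈ A, then S(·)v is
Lipschitz on [0,T] with constant e^{ωT}‖f‖, and S(·)x stays within e^{ωT}‖x - v‖ of it. Using S(·)v
as a competitor and minimising over v and f gives the bound on the K-function (`kFun_restrict_le`).
The ideal property of E turns this bound into membership in the interpolation space
(`mem_interpSpaceCLip`). Finally, x lies in the closure of the domain because otherwise K^A(x,t)/t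
would be at least δ/t, which is not integrable at 0 (`mem_closure_opDom`).

Orbits are known only as limits of perturbed implicit Euler schemes. Both bounds above come from one
estimate for two mild solutions at two different times (`IsMildSolution.norm_sub_le_of_mem`). For
it, the mutual distances of two schemes on different grids are shown to satisfy a two-index
difference inequality, and are compared with an explicit supersolution whose limit for vanishing
mesh is the desired right-hand side (`IsApproxSolution.norm_sub_le_of_approx`). -/

namespace RealInterp

/-! ### Euler growth factors and the two-index difference inequality -/

/-- The growth factors `∏ (1 - ω (s_{l+1} - s_l))⁻¹` of the implicit Euler scheme on the grid `s`. -/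
noncomputable def eulerGrowth (ω : ℝ) (s : ℕ → ℝ) (i : ℕ) : ℝ :=
  ∏ l ∈ Finset.range i, (1 - ω * (s (l + 1) - s l))⁻¹

lemma eulerGrowth_zero (ω : ℝ) (s : ℕ → ℝ) : eulerGrowth ω s 0 = 1 := by
  simp [eulerGrowth]

lemma mul_eulerGrowth_succ {ω : ℝ} {s : ℕ → ℝ} {i : ℕ} (h : ω * (s (i + 1) - s i) < 1) :
    (1 - ω * (s (i + 1) - s i)) * eulerGrowth ω s (i + 1) = eulerGrowth ω s i := by
  have : 1 - ω * (s (i + 1) - s i) ≠ 0 := by linarith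
  rw [eulerGrowth, Finset.prod_range_succ, ← eulerGrowth]
  field_simp

lemma exp_le_eulerGrowth {ω : ℝ} {s : ℕ → ℝ} {N : ℕ} (h0 : s 0 = 0)
    (h : ∀ i < N, ω * (s (i + 1) - s i) < 1) :
    ∀ i ≤ N, Real.exp (ω * s i) ≤ eulerGrowth ω s i := by
  intro i
  induction i with
  | zero => simp [eulerGrowth_zero, h0]
  | succ i ih =>
    intro hi
    have h1 := h i hi
    have h2 := ih (by omega)
    rw [← mul_eulerGrowth_succ h1] at h2
    have h3 : 1 - ω * (s (i + 1) - s i) ≤ Real.exp (-(ω * (s (i + 1) - s i))) := by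
      linarith [Real.add_one_le_exp (-(ω * (s (i + 1) - s i)))]
    have h4 : Real.exp (ω * s i)
        = Real.exp (-(ω * (s (i + 1) - s i))) * Real.exp (ω * s (i + 1)) := by
      rw [← Real.exp_add]; congr 1; ring
    have h5 : (1 - ω * (s (i + 1) - s i)) * Real.exp (ω * s (i + 1)) ≤
        (1 - ω * (s (i + 1) - s i)) * eulerGrowth ω s (i + 1) := by
      refine le_trans ?_ h2
      rw [h4]
      exact mul_le_mul_of_nonneg_right h3 (Real.exp_pos _).le
    exact le_of_mul_le_mul_left h5 (by linarith)

/-- Each factor obeys 1/(1 - x) = 1 + x/(1 - x) ≤ exp(x/(1 - ωε)) as x ≤ ωε. With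
`exp_le_eulerGrowth`, this makes the growth factors converge to e^{ωt} as the mesh vanishes. -/
lemma eulerGrowth_le_exp {ω ε : ℝ} {s : ℕ → ℝ} {N : ℕ} (hω : 0 ≤ ω) (h0 : s 0 = 0)
    (hε : ω * ε < 1) (hp : ∀ i < N, s i < s (i + 1)) (hl : ∀ i < N, s (i + 1) - s i < ε) :
    ∀ i ≤ N, eulerGrowth ω s i ≤ Real.exp (ω * s i / (1 - ω * ε)) := by
  intro i
  induction i with
  | zero => simp [eulerGrowth_zero, h0]
  | succ i ih =>
    intro hi
    have hq : 0 < 1 - ω * ε := by linarith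
    have hd : 0 < s (i + 1) - s i := by linarith [hp i hi]
    have h1 : ω * (s (i + 1) - s i) ≤ ω * ε := mul_le_mul_of_nonneg_left (hl i hi).le hω
    have h2 := ih (by omega)
    set x := ω * (s (i + 1) - s i) with hx
    have hx0 : 0 ≤ x := mul_nonneg hω hd.le
    have h3 : 1 ≤ (1 - x) * Real.exp (x / (1 - ω * ε)) := by
      have h4 : 1 + x / (1 - x) ≤ Real.exp (x / (1 - ω * ε)) := by
        refine le_trans ?_ (Real.exp_le_exp.2 (div_le_div_of_nonneg_left hx0 hq
          (by linarith : 1 - ω * ε ≤ 1 - x)))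
        linarith [Real.add_one_le_exp (x / (1 - x))]
      have h5 : (1 - x) * (1 + x / (1 - x)) = 1 := by
        have : 1 - x ≠ 0 := by linarith
        field_simp
        ring
      have h6 : 0 ≤ 1 - x := by linarith
      exact h5.symm.le.trans (mul_le_mul_of_nonneg_left h4 h6)
    have h4 : Real.exp (ω * s (i + 1) / (1 - ω * ε))
        = Real.exp (x / (1 - ω * ε)) * Real.exp (ω * s i / (1 - ω * ε)) := by
      rw [← Real.exp_add, ← add_div]; congr 2; rw [hx]; ring
    rw [← mul_eulerGrowth_succ (by linarith : ω * (s (i + 1) - s i) < 1), ← hx] at h2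
    refine le_of_mul_le_mul_left (a := 1 - x) ?_ (by linarith)
    refine h2.trans ?_
    rw [h4, ← mul_assoc]
    exact le_mul_of_one_le_left (Real.exp_pos _).le h3

/-- A comparison principle for the difference inequality on a product of two grids. -/
lemma grid_comparison {ω : ℝ} {N M : ℕ} {h k : ℕ → ℝ} {c a b : ℕ → ℕ → ℝ}
    (hh : ∀ i < N, 0 < h i) (hk : ∀ j < M, 0 < k j) (hω : ∀ i < N, ω * h i < 1)
    (ha : ∀ i < N, ∀ j < M, (h i + k j - h i * k j * ω) * a (i + 1) (j + 1) ≤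
      k j * a i (j + 1) + h i * a (i + 1) j + c i j)
    (hb : ∀ i < N, ∀ j < M, k j * b i (j + 1) + h i * b (i + 1) j + c i j ≤
      (h i + k j - h i * k j * ω) * b (i + 1) (j + 1))
    (h₁ : ∀ i ≤ N, a i 0 ≤ b i 0) (h₂ : ∀ j ≤ M, a 0 j ≤ b 0 j) :
    ∀ i ≤ N, ∀ j ≤ M, a i j ≤ b i j := by
  intro i
  induction i with
  | zero => exact fun _ => h₂
  | succ i ihi =>
    intro hi j
    induction j with
    | zero => exact fun _ => h₁ _ hi
    | succ j ihj =>
      intro hj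
      have e1 := mul_le_mul_of_nonneg_left (ihi (by omega) (j + 1) hj) (hk j hj).le
      have e2 := mul_le_mul_of_nonneg_left (ihj (by omega)) (hh i hi).le
      refine le_of_mul_le_mul_left (a := h i + k j - h i * k j * ω) ?_ ?_
      · linarith [ha i hi j hj, hb i hi j hj]
      · nlinarith [hh i hi, mul_pos (hk j hj) (sub_pos.2 (hω i hi))]

/-- The function `√(z² + r)` is a supersolution of the difference inequality. -/
lemma sqrt_supersolution {ω h k z z₁ z₂ r r₁ m : ℝ} (hh : 0 < h) (hk : 0 < k)
    (hhω : ω * h < 1) (hr : 0 ≤ r) (hr₁ : 0 ≤ r₁)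
    (hz : k * z₁ + h * z₂ = (h + k - h * k * ω) * z)
    (hm : (z₂ - z₁) ^ 2 ≤ m * (h + k))
    (hr₂ : r₁ + m * h ≤ (1 - 2 * ω * h) * r) :
    k * √(z₁ ^ 2 + r₁) + h * √(z₂ ^ 2 + r) ≤ (h + k - h * k * ω) * √(z ^ 2 + r) := by
  have hW : 0 < h + k - h * k * ω := by nlinarith [mul_pos hk (sub_pos.2 hhω)]
  have e1 : √(z₁ ^ 2 + r₁) ^ 2 = z₁ ^ 2 + r₁ := Real.sq_sqrt (by positivity)
  have e2 : √(z₂ ^ 2 + r) ^ 2 = z₂ ^ 2 + r := Real.sq_sqrt (by positivity)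
  have e3 : √(z ^ 2 + r) ^ 2 = z ^ 2 + r := Real.sq_sqrt (by positivity)
  refine le_of_sq_le_sq ?_ (by positivity)
  set D₁ := √(z₁ ^ 2 + r₁)
  set D₂ := √(z₂ ^ 2 + r)
  -- Cauchy–Schwarz with weights k and h; `c2` is the corresponding variance identity. The variance
  -- hk(z₂ - z₁)² is paid for by the increase from r₁ to r.
  have c1 : (k * D₁ + h * D₂) ^ 2 ≤ (h + k) * (k * (z₁ ^ 2 + r₁) + h * (z₂ ^ 2 + r)) := by
    rw [← e1, ← e2]
    nlinarith [mul_nonneg (mul_pos hh hk).le (sq_nonneg (D₁ - D₂))]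
  have c2 : (h + k) * (k * z₁ ^ 2 + h * z₂ ^ 2) =
      ((h + k - h * k * ω) * z) ^ 2 + h * k * (z₂ - z₁) ^ 2 := by
    rw [← hz]; ring
  have c3 : h * k * (z₂ - z₁) ^ 2 ≤ h * k * (m * (h + k)) :=
    mul_le_mul_of_nonneg_left hm (mul_pos hh hk).le
  have c4 : (h + k) * (k * (r₁ + m * h)) ≤ (h + k) * (k * ((1 - 2 * ω * h) * r)) := by
    gcongr
  -- The square of h + k - hkω exceeds the left factor by (hkω)²; this is why r may grow at the rate
  -- 2ω.
  have c5 : (h + k) * (h + k - 2 * h * k * ω) * r ≤ (h + k - h * k * ω) ^ 2 * r := by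
    refine mul_le_mul_of_nonneg_right ?_ hr
    nlinarith [sq_nonneg (h * k * ω)]
  rw [mul_pow, e3]
  nlinarith

variable {X : Type*} [NormedAddCommGroup X] [NormedSpace ℝ X]

lemma IsAccretive.norm_le_of_step {ω : ℝ} {A : Set (X × X)} (hA : IsAccretive ω A) {h : ℝ}
    (hh : 0 < h) (hω : ω * h < 1) {v v' f y g : X} (hv : (v', f - h⁻¹ • (v' - v)) ∈ A)
    (hy : (y, g) ∈ A) :
    (1 - ω * h) * ‖v' - y‖ ≤ ‖v - y‖ + h * ‖f‖ + h * ‖g‖ := by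
  have h1 := hA _ hv _ hy h hh (by linarith)
  have e : v' - y + h • (f - h⁻¹ • (v' - v) - g) = (v - y) + h • f - h • g := by
    simp only [smul_sub, smul_smul, mul_inv_cancel₀ hh.ne', one_smul]
    abel
  simp only [e] at h1
  have h2 : ‖(v - y) + h • f - h • g‖ ≤ ‖v - y‖ + ‖h • f‖ + ‖h • g‖ :=
    (norm_sub_le _ _).trans (by gcongr; exact norm_add_le _ _)
  rw [norm_smul, norm_smul, Real.norm_of_nonneg hh.le] at h2
  linarith

/-- Accretivity is applied with r = hk/(h + k): after multiplication by h + k, the new values v' and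
w' then occur only paired with the old values w and v. Since r ≤ h, the condition rω < 1 is
inherited from h. -/
lemma IsAccretive.norm_le_of_two_steps {ω : ℝ} {A : Set (X × X)} (hω : 0 ≤ ω)
    (hA : IsAccretive ω A) {h k : ℝ} (hh : 0 < h) (hk : 0 < k) (hhω : ω * h < 1)
    {v v' f w w' g : X} (hv : (v', f - h⁻¹ • (v' - v)) ∈ A)
    (hw : (w', g - k⁻¹ • (w' - w)) ∈ A) :
    (h + k - h * k * ω) * ‖v' - w'‖ ≤
      k * ‖v - w'‖ + h * ‖v' - w‖ + h * k * (‖f‖ + ‖g‖) := by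
  have hs : 0 < h + k := by positivity
  set r := h * k / (h + k) with hr
  have hr0 : 0 < r := by positivity
  have hrs : r * (h + k) = h * k := by rw [hr]; field_simp
  have hrh : r ≤ h := by
    rw [hr, div_le_iff₀ hs]; nlinarith
  have h1 := hA _ hv _ hw r hr0 (by nlinarith)
  have e : (h + k) • (v' - w' + r • (f - h⁻¹ • (v' - v) - (g - k⁻¹ • (w' - w)))) =
      k • (v - w') + h • (v' - w) + (h * k) • (f - g) := by
    rw [smul_add, smul_smul, mul_comm (h + k) r, hrs]
    have e1 : h * k * h⁻¹ = k := by field_simp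
    have e2 : h * k * k⁻¹ = h := by field_simp
    simp only [smul_sub, add_smul, smul_smul, e1, e2]
    abel
  have h2 : (h + k) * ‖v' - w' + r • (f - h⁻¹ • (v' - v) - (g - k⁻¹ • (w' - w)))‖ ≤
      k * ‖v - w'‖ + h * ‖v' - w‖ + h * k * (‖f‖ + ‖g‖) := by
    rw [← abs_of_pos hs, ← Real.norm_eq_abs, ← norm_smul, e]
    refine (norm_add₃_le).trans ?_
    rw [norm_smul, norm_smul, norm_smul, Real.norm_of_nonneg hh.le, Real.norm_of_nonneg hk.le,
      Real.norm_of_nonneg (mul_pos hh hk).le]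
    gcongr
    exact norm_sub_le _ _
  refine le_trans ?_ h2
  refine le_trans (le_of_eq ?_) (mul_le_mul_of_nonneg_left h1 hs.le)
  linear_combination (-(ω * ‖v' - w'‖)) * (-hrs)

end RealInterp

/-! ### Estimates for approximate solutions -/

namespace RealInterp
variable {X : Type*} [NormedAddCommGroup X]

/-- The accumulated errors of an approximate solution. -/
noncomputable def accError (s : ℕ → ℝ) (f : ℕ → X) (i : ℕ) : ℝ :=
  ∑ l ∈ Finset.range i, (s (l + 1) - s l) * ‖f (l + 1)‖

lemma accError_succ (s : ℕ → ℝ) (f : ℕ → X) (i : ℕ) :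
    accError s f (i + 1) = accError s f i + (s (i + 1) - s i) * ‖f (i + 1)‖ :=
  Finset.sum_range_succ _ _

variable [NormedSpace ℝ X]

namespace IsApproxSolution

variable {A : Set (X × X)} {T ε : ℝ} {N : ℕ} {s : ℕ → ℝ} {v f : ℕ → X}

lemma accError_lt (h : IsApproxSolution A T ε N s v f) {i : ℕ} (hi : i ≤ N) :
    accError s f i < ε := by
  refine lt_of_le_of_lt ?_ h.error
  refine Finset.sum_le_sum_of_subset_of_nonneg (by simpa using hi) fun j hj _ => ?_
  have := h.step_pos j (by simpa using hj)
  exact mul_nonneg (by linarith) (norm_nonneg _)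

lemma monotone_grid (h : IsApproxSolution A T ε N s v f) {i j : ℕ} (hij : i ≤ j) (hj : j ≤ N) :
    s i ≤ s j := by
  induction j, hij using Nat.le_induction with
  | base => exact le_rfl
  | succ j _ ih => exact (ih (by omega)).trans (h.step_pos j hj).le

lemma mul_step_lt (h : IsApproxSolution A T ε N s v f) {ω : ℝ} (hω : 0 ≤ ω) {c : ℝ}
    (hε : ω * ε ≤ c) {i : ℕ} (hi : i < N) (hc : 0 < c) : ω * (s (i + 1) - s i) < c := by
  rcases hω.eq_or_lt with rfl | hω
  · simpa using hc
  · exact (mul_lt_mul_of_pos_left (h.step_lt i hi) hω).trans_le hε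

lemma one_le_eulerGrowth (h : IsApproxSolution A T ε N s v f) {ω : ℝ} (hω : 0 ≤ ω)
    (hε : ω * ε ≤ 1) {i : ℕ} (hi : i ≤ N) : 1 ≤ eulerGrowth ω s i := by
  refine le_trans ?_ (exp_le_eulerGrowth h.start
    (fun i hi => h.mul_step_lt hω hε hi one_pos) i hi)
  refine Real.one_le_exp (mul_nonneg hω ?_)
  rw [← h.start]
  exact h.monotone_grid (Nat.zero_le i) hi

/-- The distance of an approximate solution from a point of the domain. -/
lemma norm_sub_le (h : IsApproxSolution A T ε N s v f) {ω : ℝ} (hω : 0 < ω)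
    (hA : IsAccretive ω A) (hε : ω * ε ≤ 1) {y g : X} (hy : (y, g) ∈ A) {i : ℕ} (hi : i ≤ N) :
    ‖v i - y‖ ≤ eulerGrowth ω s i * (‖v 0 - y‖ + accError s f i) +
      ‖g‖ * ((eulerGrowth ω s i - 1) / ω) := by
  induction i with
  | zero => simp [eulerGrowth_zero, accError]
  | succ i ih =>
    have h1 := h.mul_step_lt hω.le hε hi one_pos
    have h2 := hA.norm_le_of_step (sub_pos.2 (h.step_pos i hi)) h1 (h.mem i hi) hy
    have h3 := ih (by omega)
    have h4 := mul_eulerGrowth_succ h1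
    have h5 := h.one_le_eulerGrowth hω.le hε (by omega : i ≤ N)
    rw [accError_succ]
    set d := s (i + 1) - s i with hd
    have hd0 : 0 < d := sub_pos.2 (h.step_pos i hi)
    refine le_of_mul_le_mul_left (a := 1 - ω * d) ?_ (by linarith)
    have e : (1 - ω * d) * (eulerGrowth ω s (i + 1) *
        (‖v 0 - y‖ + (accError s f i + d * ‖f (i + 1)‖)) +
        ‖g‖ * ((eulerGrowth ω s (i + 1) - 1) / ω)) =
        eulerGrowth ω s i * (‖v 0 - y‖ + accError s f i) +
        eulerGrowth ω s i * (d * ‖f (i + 1)‖) +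
        ‖g‖ * ((eulerGrowth ω s i - 1) / ω) + d * ‖g‖ := by
      rw [← h4]; field_simp; ring
    rw [e]
    have h6 : d * ‖f (i + 1)‖ ≤ eulerGrowth ω s i * (d * ‖f (i + 1)‖) :=
      le_mul_of_one_le_left (by positivity) h5
    linarith

/-- The estimate of the distance of two approximate solutions on different grids. -/
lemma norm_sub_le_of_approx (h : IsApproxSolution A T ε N s v f) {N' : ℕ} {s' : ℕ → ℝ}
    {v' f' : ℕ → X} (h' : IsApproxSolution A T ε N' s' v' f') {ω : ℝ} (hω : 0 < ω)
    (hA : IsAccretive ω A) (hε : 2 * ω * ε ≤ 1) {y g : X} (hy : (y, g) ∈ A) {m : ℝ}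
    (hm : ∀ i ≤ N, eulerGrowth ω s i ≤ m) (hm' : ∀ j ≤ N', eulerGrowth ω s' j ≤ m)
    (hε₀ : 0 < ε) {i : ℕ} (hi : i ≤ N) {j : ℕ} (hj : j ≤ N') :
    ‖v i - v' j‖ ≤ eulerGrowth ω s i * (‖v 0 - y‖ + accError s f i) +
      eulerGrowth ω s' j * (‖v' 0 - y‖ + accError s' f' j) +
      ‖g‖ * √(((eulerGrowth ω s i - eulerGrowth ω s' j) / ω) ^ 2 +
        (m ^ 2 * ε / ω) * (eulerGrowth (2 * ω) s i - 1)) := by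
  have hε1 : ω * ε ≤ 1 := by nlinarith
  have h2ω : 0 ≤ 2 * ω := by positivity
  have hr (i) (hi : i ≤ N) : 0 ≤ (m ^ 2 * ε / ω) * (eulerGrowth (2 * ω) s i - 1) :=
    mul_nonneg (by positivity) (sub_nonneg.2 (h.one_le_eulerGrowth h2ω hε hi))
  -- Growth factors in i alone or in j alone solve the homogeneous difference equation exactly,
  -- hence so does their difference, which enters the square root. The accumulated errors absorb the
  -- inhomogeneity c.
  refine grid_comparison (ω := ω) (N := N) (M := N') (h := fun i => s (i + 1) - s i)
    (k := fun j => s' (j + 1) - s' j) (a := fun i j => ‖v i - v' j‖)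
    (c := fun i j => (s (i + 1) - s i) * (s' (j + 1) - s' j) * (‖f (i + 1)‖ + ‖f' (j + 1)‖))
    (b := fun i j => eulerGrowth ω s i * (‖v 0 - y‖ + accError s f i) +
      eulerGrowth ω s' j * (‖v' 0 - y‖ + accError s' f' j) +
      ‖g‖ * √(((eulerGrowth ω s i - eulerGrowth ω s' j) / ω) ^ 2 +
        (m ^ 2 * ε / ω) * (eulerGrowth (2 * ω) s i - 1)))
    (fun i hi => sub_pos.2 (h.step_pos i hi)) (fun i hi => sub_pos.2 (h'.step_pos i hi))
    (fun i hi => h.mul_step_lt hω.le hε1 hi one_pos) ?_ ?_ ?_ ?_ i hi j hj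
  · intro i hi j hj
    exact hA.norm_le_of_two_steps hω.le (sub_pos.2 (h.step_pos i hi))
      (sub_pos.2 (h'.step_pos j hj)) (h.mul_step_lt hω.le hε1 hi one_pos) (h.mem i hi)
      (h'.mem j hj)
  · intro i hi j hj
    simp only [accError_succ]
    have p1 := mul_eulerGrowth_succ (h.mul_step_lt hω.le hε1 hi one_pos)
    have p2 := mul_eulerGrowth_succ (h.mul_step_lt h2ω hε hi one_pos)
    have q1 := mul_eulerGrowth_succ (h'.mul_step_lt hω.le hε1 hj one_pos)
    have gP := h.one_le_eulerGrowth hω.le hε1 hi.le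
    have gQ := h'.one_le_eulerGrowth hω.le hε1 hj.le
    have gP2 := h.one_le_eulerGrowth h2ω hε hi
    have mP := hm (i + 1) hi
    have mQ := hm' (j + 1) hj
    have gP' := h.one_le_eulerGrowth hω.le hε1 hi
    have gQ' := h'.one_le_eulerGrowth hω.le hε1 hj
    have hωh := h.mul_step_lt hω.le hε1 hi one_pos
    have hr0 := hr i hi.le
    have hr1 := hr (i + 1) hi
    have hh := sub_pos.2 (h.step_pos i hi)
    have hk := sub_pos.2 (h'.step_pos j hj)
    have hhε := (h.step_lt i hi).le
    have hkε := (h'.step_lt j hj).le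
    set d := s (i + 1) - s i
    set k := s' (j + 1) - s' j
    set P := eulerGrowth ω s i
    set P' := eulerGrowth ω s (i + 1)
    set R := eulerGrowth (2 * ω) s i
    set R' := eulerGrowth (2 * ω) s (i + 1)
    set Q := eulerGrowth ω s' j
    set Q' := eulerGrowth ω s' (j + 1)
    have hz : (P' - Q) / ω - (P - Q') / ω = d * P' + k * Q' := by
      rw [← p1, ← q1]; field_simp; ring
    -- As z₂ - z₁ ≤ m(d + k) and d + k ≤ 2ε, the variance constant is 2m²ε. The correction (m²ε/ω)(R
    -- - 1), with R growing at rate 2ω, solves the recursion required of r with equality.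
    have hD := sqrt_supersolution (ω := ω) (h := d) (k := k) (z := (P' - Q') / ω)
      (z₁ := (P - Q') / ω) (z₂ := (P' - Q) / ω) (r := m ^ 2 * ε / ω * (R' - 1))
      (r₁ := m ^ 2 * ε / ω * (R - 1)) (m := 2 * (m ^ 2 * ε)) hh hk hωh hr1 hr0
      (by rw [← p1, ← q1]; field_simp; ring)
      (by
        rw [hz]
        have : d * P' + k * Q' ≤ m * (d + k) := by nlinarith
        have h2 : 0 ≤ d * P' + k * Q' := by positivity
        calc (d * P' + k * Q') ^ 2 ≤ (m * (d + k)) ^ 2 := by gcongr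
          _ = m ^ 2 * (d + k) * (d + k) := by ring
          _ ≤ m ^ 2 * (2 * ε) * (d + k) := by gcongr; linarith
          _ = _ := by ring)
      (by
        rw [← p2]
        apply le_of_eq
        field_simp
        ring)
    have hD' := mul_le_mul_of_nonneg_left hD (norm_nonneg g)
    have eP : d * k * ‖f (i + 1)‖ ≤ d * k * ‖f (i + 1)‖ * P :=
      le_mul_of_one_le_right (by positivity) gP
    have eQ : d * k * ‖f' (j + 1)‖ ≤ d * k * ‖f' (j + 1)‖ * Q :=
      le_mul_of_one_le_right (by positivity) gQ
    have i1 : (d + k - d * k * ω) * (P' * (‖v 0 - y‖ + (accError s f i + d * ‖f (i + 1)‖))) =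
        k * (P * (‖v 0 - y‖ + accError s f i)) +
        d * (P' * (‖v 0 - y‖ + (accError s f i + d * ‖f (i + 1)‖))) +
        d * k * ‖f (i + 1)‖ * P := by
      rw [← p1]; ring
    have i2 : (d + k - d * k * ω) *
        (Q' * (‖v' 0 - y‖ + (accError s' f' j + k * ‖f' (j + 1)‖))) =
        d * (Q * (‖v' 0 - y‖ + accError s' f' j)) +
        k * (Q' * (‖v' 0 - y‖ + (accError s' f' j + k * ‖f' (j + 1)‖))) +
        d * k * ‖f' (j + 1)‖ * Q := by
      rw [← q1]; ring
    linarith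
  · intro i hi
    -- On the edges of the index grid, one scheme is still at its initial value, so the triangle
    -- inequality through y suffices.
    have h1 := h.norm_sub_le hω hA hε1 hy hi
    have h2 := hr i hi
    simp only [eulerGrowth_zero, accError, Finset.range_zero, Finset.sum_empty, add_zero, one_mul]
    simp only [accError] at h1
    have h3 : (eulerGrowth ω s i - 1) / ω ≤ √(((eulerGrowth ω s i - 1) / ω) ^ 2 +
        (m ^ 2 * ε / ω) * (eulerGrowth (2 * ω) s i - 1)) :=
      Real.le_sqrt_of_sq_le (by linarith)
    have h4 := mul_le_mul_of_nonneg_left h3 (norm_nonneg g)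
    have h5 : ‖v i - v' 0‖ ≤ ‖v i - y‖ + ‖v' 0 - y‖ := by
      rw [norm_sub_rev (v' 0) y]; exact norm_sub_le_norm_sub_add_norm_sub _ _ _
    linarith
  · intro j hj
    have h1 := h'.norm_sub_le hω hA hε1 hy hj
    simp only [eulerGrowth_zero, accError, Finset.range_zero, Finset.sum_empty, add_zero, one_mul,
      sub_self, mul_zero]
    simp only [accError] at h1
    have h3 : (eulerGrowth ω s' j - 1) / ω ≤ √(((1 - eulerGrowth ω s' j) / ω) ^ 2) :=
      Real.le_sqrt_of_sq_le (le_of_eq (by ring))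
    have h4 := mul_le_mul_of_nonneg_left h3 (norm_nonneg g)
    have h5 : ‖v 0 - v' j‖ ≤ ‖v 0 - y‖ + ‖v' j - y‖ := by
      rw [norm_sub_rev (v' j) y]; exact norm_sub_le_norm_sub_add_norm_sub _ _ _
    linarith

end IsApproxSolution
end RealInterp

/-! ### From approximate to mild solutions -/

namespace RealInterp
variable {X : Type*} [NormedAddCommGroup X] [NormedSpace ℝ X] {A : Set (X × X)}

namespace IsMildSolution

/-- The index i is that of the first grid point not before t. It exists because the grid ends after
T - ε ≥ t, and it overshoots t by less than one step. The case i = 0 occurs only for t = 0, where v₀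
itself approximates the solution. -/
lemma exists_approx {x : X} {u : ℝ → X} (h : IsMildSolution A x u) {t T ε : ℝ} (ht : 0 ≤ t)
    (hε : 0 < ε) (hT : t + ε ≤ T) :
    ∃ (N : ℕ) (s : ℕ → ℝ) (v f : ℕ → X) (i : ℕ), IsApproxSolution A T ε N s v f ∧
      ‖x - v 0‖ ≤ ε ∧ i ≤ N ∧ t ≤ s i ∧ s i ≤ t + ε ∧ ‖u t - v i‖ ≤ ε := by
  obtain ⟨-, h0, h1⟩ := h
  obtain ⟨N, s, v, f, ha, hx, hv⟩ := h1 T (by linarith) ε hε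
  rw [h0] at hx
  have hex : ∃ i, t ≤ s i := ⟨N, by linarith [ha.lt_end]⟩
  classical
  have hfind := Nat.find_spec hex
  have hN : Nat.find hex ≤ N := Nat.find_min' hex (by linarith [ha.lt_end])
  rcases hi : Nat.find hex with _ | j
  · rw [hi, ha.start] at hfind
    obtain rfl : t = 0 := le_antisymm hfind ht
    exact ⟨N, s, v, f, 0, ha, hx, Nat.zero_le _, by rw [ha.start], by rw [ha.start]; linarith,
      by rwa [h0]⟩
  · rw [hi] at hfind hN
    have hj : s j < t := not_le.1 (Nat.find_min hex (m := j) (by omega))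
    exact ⟨N, s, v, f, j + 1, ha, hx, hN, hfind, by linarith [ha.step_lt j hN],
      hv j hN t ⟨hj, hfind⟩⟩

/-- Comparison of two mild solutions at two times, through a point of the domain. -/
lemma norm_sub_le_of_mem {x x' : X} {u u' : ℝ → X} (h : IsMildSolution A x u)
    (h' : IsMildSolution A x' u') {ω : ℝ} (hω : 0 < ω) (hA : IsAccretive ω A) {y g : X}
    (hy : (y, g) ∈ A) {t t' : ℝ} (ht : 0 ≤ t) (ht' : 0 ≤ t') :
    ‖u t - u' t'‖ ≤ Real.exp (ω * t) * ‖x - y‖ + Real.exp (ω * t') * ‖x' - y‖ +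
      ‖g‖ * (|Real.exp (ω * t) - Real.exp (ω * t')| / ω) := by
  set T := max t t' + 1
  set B : ℝ → ℝ → ℝ := fun r ε => Real.exp (ω * (r + ε) / (1 - ω * ε)) with hB
  set M : ℝ → ℝ := fun ε => Real.exp (ω * T / (1 - ω * ε))
  set R : ℝ → ℝ := fun ε => Real.exp (2 * ω * T / (1 - 2 * ω * ε))
  set Z : ℝ → ℝ := fun ε => max (B t ε - Real.exp (ω * t')) (B t' ε - Real.exp (ω * t)) with hZ
  -- F majorises the distance for small ε, is continuous at 0, and F 0 is the claimed bound. The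
  -- outer 2ε comes from approximating u and u'; each inner 2ε from the initial value and the
  -- accumulated errors.
  set F : ℝ → ℝ := fun ε => 2 * ε + (B t ε * (‖x - y‖ + 2 * ε) + B t' ε * (‖x' - y‖ + 2 * ε) +
    ‖g‖ * √((Z ε / ω) ^ 2 + (M ε ^ 2 * ε / ω) * (R ε - 1)))
  have hBc (r : ℝ) : ContinuousAt (B r) 0 := by
    refine Real.continuous_exp.continuousAt.comp (ContinuousAt.div (by fun_prop) (by fun_prop) ?_)
    simp
  have hMc : ContinuousAt M 0 := by
    refine Real.continuous_exp.continuousAt.comp (ContinuousAt.div (by fun_prop) (by fun_prop) ?_)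
    simp
  have hRc : ContinuousAt R 0 := by
    refine Real.continuous_exp.continuousAt.comp (ContinuousAt.div (by fun_prop) (by fun_prop) ?_)
    simp
  have hZc : ContinuousAt Z 0 :=
    ((hBc t).sub continuousAt_const).max ((hBc t').sub continuousAt_const)
  have hFc : ContinuousAt F 0 := by
    have h1 := hBc t
    have h2 := hBc t'
    refine (continuousAt_const.mul continuousAt_id).add (((h1.mul ?_).add (h2.mul ?_)).add
      (continuousAt_const.mul (Real.continuous_sqrt.continuousAt.comp
        (((hZc.div_const ω).pow 2).add ((((hMc.pow 2).mul continuousAt_id).div_const ω).mul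
          (hRc.sub continuousAt_const))))))
    all_goals fun_prop
  have hF0 : F 0 = Real.exp (ω * t) * ‖x - y‖ + Real.exp (ω * t') * ‖x' - y‖ +
      ‖g‖ * (|Real.exp (ω * t) - Real.exp (ω * t')| / ω) := by
    have hZ0 : Z 0 = |Real.exp (ω * t) - Real.exp (ω * t')| := by
      simp only [hZ, hB, add_zero, mul_zero, sub_zero, div_one]
      rw [← neg_sub (Real.exp (ω * t)) (Real.exp (ω * t'))]
      rfl
    have hs : √((Z 0 / ω) ^ 2 + (M 0 ^ 2 * 0 / ω) * (R 0 - 1)) = Z 0 / ω := by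
      rw [mul_zero, zero_div, zero_mul, add_zero, Real.sqrt_sq]
      rw [hZ0]; positivity
    change 2 * 0 + (B t 0 * (‖x - y‖ + 2 * 0) + B t' 0 * (‖x' - y‖ + 2 * 0) +
      ‖g‖ * √((Z 0 / ω) ^ 2 + (M 0 ^ 2 * 0 / ω) * (R 0 - 1))) = _
    rw [hs, hZ0]
    simp [hB]
  rw [← hF0]
  refine ge_of_tendsto (hFc.tendsto.mono_left (nhdsWithin_le_nhds (s := Ioi 0))) ?_
  -- The bound 1 keeps t + ε and t' + ε below T; the bound 1/(2ω) keeps the growth factors of rate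
  -- 2ω under control.
  have hev : ∀ᶠ ε in nhdsWithin (0 : ℝ) (Ioi 0), ε < min 1 (1 / (2 * ω)) := by
    refine nhdsWithin_le_nhds (Iio_mem_nhds ?_)
    positivity
  filter_upwards [hev, self_mem_nhdsWithin] with ε hε1 (hε0 : 0 < ε)
  have hεT : ε < 1 := hε1.trans_le (min_le_left _ _)
  have hεω : 2 * ω * ε < 1 := by
    have := hε1.trans_le (min_le_right _ _)
    rwa [lt_div_iff₀ (by positivity), mul_comm] at this
  have hεω' : ω * ε < 1 := by nlinarith
  obtain ⟨N, s, v, f, i, ha, hx, hi, h1, h2, h3⟩ := h.exists_approx (T := T) ht hε0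
    (by linarith [le_max_left t t'])
  obtain ⟨N', s', v', f', j, ha', hx', hj, h1', h2', h3'⟩ := h'.exists_approx (T := T) ht' hε0
    (by linarith [le_max_right t t'])
  have q1 : 0 < 1 - ω * ε := by linarith
  have q2 : 0 < 1 - 2 * ω * ε := by linarith
  have up {N s} {v f : ℕ → X} (ha : IsApproxSolution A T ε N s v f) {i} (hi : i ≤ N) :
      eulerGrowth ω s i ≤ Real.exp (ω * s i / (1 - ω * ε)) :=
    eulerGrowth_le_exp hω.le ha.start hεω' ha.step_pos ha.step_lt i hi
  have low {N s} {v f : ℕ → X} (ha : IsApproxSolution A T ε N s v f) {i} (hi : i ≤ N) :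
      Real.exp (ω * s i) ≤ eulerGrowth ω s i :=
    exp_le_eulerGrowth ha.start (fun i hi => ha.mul_step_lt hω.le hεω'.le hi one_pos) i hi
  have upM {N s} {v f : ℕ → X} (ha : IsApproxSolution A T ε N s v f) {i} (hi : i ≤ N) :
      s i ≤ T := (ha.monotone_grid hi le_rfl).trans ha.end_le
  have hPM {N s} {v f : ℕ → X} (ha : IsApproxSolution A T ε N s v f) :
      ∀ i ≤ N, eulerGrowth ω s i ≤ M ε := fun i hi => by
    refine (up ha hi).trans (Real.exp_le_exp.2 ?_)
    have := upM ha hi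
    gcongr
  have key := ha.norm_sub_le_of_approx ha' hω hA hεω.le hy (hPM ha) (hPM ha') hε0 hi hj
  have hR' : eulerGrowth (2 * ω) s i ≤ R ε := by
    refine (eulerGrowth_le_exp (by positivity) ha.start hεω ha.step_pos ha.step_lt i hi).trans
      (Real.exp_le_exp.2 ?_)
    have := upM ha hi
    gcongr
  have hR1 := ha.one_le_eulerGrowth (ω := 2 * ω) (by positivity) hεω.le hi
  have hP : eulerGrowth ω s i ≤ B t ε :=
    (up ha hi).trans (Real.exp_le_exp.2 (by gcongr))
  have hQ : eulerGrowth ω s' j ≤ B t' ε :=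
    (up ha' hj).trans (Real.exp_le_exp.2 (by gcongr))
  have hP1 : Real.exp (ω * t) ≤ eulerGrowth ω s i :=
    (Real.exp_le_exp.2 (by gcongr)).trans (low ha hi)
  have hQ1 : Real.exp (ω * t') ≤ eulerGrowth ω s' j :=
    (Real.exp_le_exp.2 (by gcongr)).trans (low ha' hj)
  have hPQ : |eulerGrowth ω s i - eulerGrowth ω s' j| ≤ Z ε := by
    rw [abs_le']
    exact ⟨(sub_le_sub hP hQ1).trans (le_max_left _ _),
      by rw [neg_sub]; exact (sub_le_sub hQ hP1).trans (le_max_right _ _)⟩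
  have hsq : ((eulerGrowth ω s i - eulerGrowth ω s' j) / ω) ^ 2 ≤ (Z ε / ω) ^ 2 := by
    rw [div_pow, div_pow, ← sq_abs]
    gcongr
  have hv0 : ‖v 0 - y‖ + accError s f i ≤ ‖x - y‖ + 2 * ε := by
    have := norm_sub_le_norm_sub_add_norm_sub (v 0) x y
    rw [norm_sub_rev (v 0) x] at this
    linarith [ha.accError_lt hi]
  have hv0' : ‖v' 0 - y‖ + accError s' f' j ≤ ‖x' - y‖ + 2 * ε := by
    have := norm_sub_le_norm_sub_add_norm_sub (v' 0) x' y
    rw [norm_sub_rev (v' 0) x'] at this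
    linarith [ha'.accError_lt hj]
  have b1 : eulerGrowth ω s i * (‖v 0 - y‖ + accError s f i) ≤ B t ε * (‖x - y‖ + 2 * ε) :=
    (mul_le_mul_of_nonneg_left hv0 ((Real.exp_pos _).le.trans hP1)).trans
      (mul_le_mul_of_nonneg_right hP (by positivity))
  have b2 : eulerGrowth ω s' j * (‖v' 0 - y‖ + accError s' f' j) ≤
      B t' ε * (‖x' - y‖ + 2 * ε) :=
    (mul_le_mul_of_nonneg_left hv0' ((Real.exp_pos _).le.trans hQ1)).trans
      (mul_le_mul_of_nonneg_right hQ (by positivity))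
  have b3 : ‖g‖ * √(((eulerGrowth ω s i - eulerGrowth ω s' j) / ω) ^ 2 +
        (M ε ^ 2 * ε / ω) * (eulerGrowth (2 * ω) s i - 1)) ≤
      ‖g‖ * √((Z ε / ω) ^ 2 + (M ε ^ 2 * ε / ω) * (R ε - 1)) := by
    gcongr
  have tri : ‖u t - u' t'‖ ≤ ‖u t - v i‖ + ‖v i - v' j‖ + ‖u' t' - v' j‖ := by
    have e : u t - u' t' = (u t - v i) + (v i - v' j) - (u' t' - v' j) := by abel
    rw [e]
    exact (norm_sub_le _ _).trans (by gcongr; exact norm_add_le _ _)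
  change _ ≤ 2 * ε + (_ + _ + _)
  linarith

end IsMildSolution

lemma IsAccretive.mono {ω ω' : ℝ} (hA : IsAccretive ω A) (hω : ω ≤ ω') : IsAccretive ω' A := by
  intro p hp q hq r hr hr'
  have h1 : r * ω ≤ r * ω' := mul_le_mul_of_nonneg_left hω hr.le
  refine le_trans ?_ (hA p hp q hq r hr (by linarith))
  gcongr

lemma abs_exp_sub_exp_le {ω t t' T : ℝ} (hω : 0 < ω) (ht : t ≤ T) (ht' : t' ≤ T) :
    |Real.exp (ω * t) - Real.exp (ω * t')| ≤ ω * (Real.exp (ω * T) * |t - t'|) := by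
  wlog h : t' ≤ t generalizing t t'
  · rw [abs_sub_comm, abs_sub_comm t]
    exact this ht' ht (by linarith)
  rw [abs_of_nonneg (sub_nonneg.2 (Real.exp_le_exp.2 (by gcongr))),
    abs_of_nonneg (sub_nonneg.2 h)]
  have h1 : Real.exp (ω * t') = Real.exp (ω * t) * Real.exp (-(ω * (t - t'))) := by
    rw [← Real.exp_add]; congr 1; ring
  have h2 := Real.add_one_le_exp (-(ω * (t - t')))
  have h3 : Real.exp (ω * t) ≤ Real.exp (ω * T) := Real.exp_le_exp.2 (by gcongr)
  have h4 : 0 ≤ ω * (t - t') := mul_nonneg hω.le (by linarith)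
  calc Real.exp (ω * t) - Real.exp (ω * t')
      = Real.exp (ω * t) * (1 - Real.exp (-(ω * (t - t')))) := by rw [h1]; ring
    _ ≤ Real.exp (ω * t) * (ω * (t - t')) := by gcongr; linarith
    _ ≤ Real.exp (ω * T) * (ω * (t - t')) := by gcongr
    _ = _ := by ring

/-- The two-time estimate divides by ω; passing to ω' > ω and then to the limit includes ω = 0. -/
lemma le_of_forall_gt_exp {ω t a b : ℝ} (h : ∀ ω' > ω, a ≤ Real.exp (ω' * t) * b) :
    a ≤ Real.exp (ω * t) * b := by
  have hc : ContinuousAt (fun ω' => Real.exp (ω' * t) * b) ω := by fun_prop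
  exact ge_of_tendsto (hc.tendsto.mono_left (nhdsWithin_le_nhds (s := Ioi ω)))
    (Filter.mem_of_superset self_mem_nhdsWithin h)

/-- Mild solutions depend continuously on their initial values. -/
theorem IsMildSolution.norm_sub_le {x x' : X} {u u' : ℝ → X} (h : IsMildSolution A x u)
    (h' : IsMildSolution A x' u') {ω : ℝ} (hω : 0 ≤ ω) (hA : IsAccretive ω A)
    (hx : x ∈ closure (opDom A)) {t : ℝ} (ht : 0 ≤ t) :
    ‖u t - u' t‖ ≤ Real.exp (ω * t) * ‖x - x'‖ := by
  refine le_of_forall_gt_exp fun ω' hω' => ?_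
  have hmap : ‖u t - u' t‖ ≤ Real.exp (ω' * t) * ‖x - x‖ + Real.exp (ω' * t) * ‖x' - x‖ := by
    -- At equal times the term with ‖g‖ vanishes, so the estimate is a closed condition on y and
    -- extends to y = x.
    refine closure_minimal (s := opDom A) (t := {y | ‖u t - u' t‖ ≤
      Real.exp (ω' * t) * ‖x - y‖ + Real.exp (ω' * t) * ‖x' - y‖}) ?_
      (isClosed_le (by fun_prop) (by fun_prop)) hx
    rintro y ⟨g, hy⟩
    simpa using h.norm_sub_le_of_mem h' (hω.trans_lt hω') (hA.mono hω'.le) hy ht ht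
  simpa [norm_sub_rev x'] using hmap

/-- Mild solutions that start in the domain are Lipschitz continuous. -/
theorem IsMildSolution.norm_sub_le_mul {x g : X} {u : ℝ → X} (h : IsMildSolution A x u)
    {ω : ℝ} (hω : 0 ≤ ω) (hA : IsAccretive ω A) (hx : (x, g) ∈ A) {T t t' : ℝ} (ht : 0 ≤ t)
    (ht' : 0 ≤ t') (hT : t ≤ T) (hT' : t' ≤ T) :
    ‖u t - u t'‖ ≤ Real.exp (ω * T) * (‖g‖ * |t - t'|) := by
  refine le_of_forall_gt_exp fun ω' hω' => ?_
  have hω0 := hω.trans_lt hω'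
  have h1 := h.norm_sub_le_of_mem h hω0 (hA.mono hω'.le) hx ht ht'
  simp only [sub_self, norm_zero, mul_zero, zero_add] at h1
  refine h1.trans ?_
  have h2 := abs_exp_sub_exp_le hω0 hT hT'
  calc _ ≤ ‖g‖ * (Real.exp (ω' * T) * |t - t'|) := by
        gcongr
        rwa [div_le_iff₀ hω0, mul_comm _ ω']
    _ = _ := by ring

end RealInterp

/-! ### Banach function spaces -/

namespace RealInterp

/-- Both summands of f are multiplied by g/f, which has modulus at most 1 (and is 0 where f = 0). -/
lemma MemSum.of_norm_le {f g : ℝ →ₘ[halfLine] ℂ} (hf : MemSum f)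
    (h : ∀ᵐ t ∂halfLine, ‖g t‖ ≤ ‖f t‖) : MemSum g := by
  obtain ⟨f₁, f₂, h₁, h₂, rfl⟩ := hf
  set f := f₁ + f₂ with hf
  have hm (p : ℝ →ₘ[halfLine] ℂ) :
      AEStronglyMeasurable (fun t => g t / f t * p t) halfLine :=
    (g.aestronglyMeasurable.aemeasurable.div f.aestronglyMeasurable.aemeasurable
      |>.mul p.aestronglyMeasurable.aemeasurable).aestronglyMeasurable
  have hle (p : ℝ →ₘ[halfLine] ℂ) : ∀ᵐ t ∂halfLine, ‖g t / f t * p t‖ ≤ ‖p t‖ := by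
    filter_upwards [h] with t ht
    rw [norm_mul, norm_div]
    exact mul_le_of_le_one_left (norm_nonneg _) (div_le_one_of_le₀ ht (norm_nonneg _))
  refine ⟨AEEqFun.mk _ (hm f₁), AEEqFun.mk _ (hm f₂),
    (h₁.of_le (hm f₁) (hle f₁)).ae_eq (AEEqFun.coeFn_mk _ _).symm,
    (h₂.of_le (hm f₂) (hle f₂)).ae_eq (AEEqFun.coeFn_mk _ _).symm, ?_⟩
  refine AEEqFun.ext ?_
  filter_upwards [h, AEEqFun.coeFn_add f₁ f₂,
    AEEqFun.coeFn_add (AEEqFun.mk _ (hm f₁)) (AEEqFun.mk _ (hm f₂)),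
    AEEqFun.coeFn_mk _ (hm f₁), AEEqFun.coeFn_mk _ (hm f₂)] with t ht e₁ e₂ e₃ e₄
  rw [e₂, Pi.add_apply, e₃, e₄, ← mul_add]
  have e₅ : f₁ t + f₂ t = f t := e₁.symm
  rw [e₅]
  by_cases h0 : f t = 0
  · have : g t = 0 := by simpa [h0] using ht
    simp [this]
  · field_simp

lemma MemSum.integrableOn {f : ℝ →ₘ[halfLine] ℂ} (hf : MemSum f) (τ : ℝ) :
    IntegrableOn f (Ioo 0 τ) := by
  obtain ⟨f₁, f₂, h₁, h₂, rfl⟩ := hf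
  have hle : (volume.restrict (Ioo 0 τ) : Measure ℝ) ≤ halfLine :=
    Measure.restrict_mono Ioo_subset_Ioi_self le_rfl
  have i₁ : Integrable f₁ (volume.restrict (Ioo 0 τ)) :=
    (memLp_one_iff_integrable.1 h₁).mono_measure hle
  have i₂ : Integrable f₂ (volume.restrict (Ioo 0 τ)) :=
    (h₂.mono_measure hle).integrable le_top
  exact (i₁.add i₂).congr ((AEEqFun.coeFn_add f₁ f₂).filter_mono (ae_mono hle)).symm

namespace BanachFunctionSpace

variable (E : BanachFunctionSpace)

lemma extNorm_lt_top_iff {G : ℝ → ℝ≥0∞} : E.extNorm G < ∞ ↔ ∃ f : E.carrier,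
    ∀ᵐ t ∂halfLine, G t ≠ ∞ ∧ (f : ℝ →ₘ[halfLine] ℂ) t = (((G t).toReal : ℝ) : ℂ) := by
  simp only [extNorm, iInf_lt_iff, ENNReal.ofReal_lt_top, exists_prop, and_true]

lemma extNorm_lt_top_of_le {G : ℝ → ℝ≥0∞} (hG : Measurable G) (f : E.carrier)
    (h : ∀ᵐ t ∂halfLine, G t ≤ ‖(f : ℝ →ₘ[halfLine] ℂ) t‖ₑ) : E.extNorm G < ∞ := by
  have hm : AEStronglyMeasurable (fun t => (((G t).toReal : ℝ) : ℂ)) halfLine :=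
    (Complex.measurable_ofReal.comp hG.ennreal_toReal).aestronglyMeasurable
  have hle : ∀ᵐ t ∂halfLine, ‖AEEqFun.mk _ hm t‖ ≤ ‖(f : ℝ →ₘ[halfLine] ℂ) t‖ := by
    filter_upwards [h, AEEqFun.coeFn_mk _ hm] with t ht e
    rw [e, Complex.norm_real, Real.norm_of_nonneg ENNReal.toReal_nonneg, ← toReal_enorm]
    exact ENNReal.toReal_mono enorm_ne_top ht
  obtain ⟨hg, -⟩ := E.ideal f _ ((E.subset_sum f f.2).of_norm_le hle) hle
  refine E.extNorm_lt_top_iff.2 ⟨⟨_, hg⟩, ?_⟩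
  filter_upwards [h, AEEqFun.coeFn_mk _ hm] with t ht e
  exact ⟨ne_top_of_le_ne_top enorm_ne_top ht, e⟩

/-- This is the Hardy operator applied to the indicator of (0,1]. It puts a function with tail 1/t
into E, which controls K(u,t)/t for large t. -/
lemma exists_min_one_inv (hE : E.HardyBounded) : ∃ g : E.carrier,
    ∀ᵐ t ∂halfLine, (g : ℝ →ₘ[halfLine] ℂ) t = ((t⁻¹ * min t 1 : ℝ) : ℂ) := by
  set φ : ℝ → ℂ := (Ioc (0 : ℝ) 1).indicator fun _ => 1 with hφ
  have hmem (p : ℝ≥0∞) : MemLp φ p halfLine := by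
    refine memLp_indicator_const p measurableSet_Ioc 1 (Or.inr ?_)
    refine ne_top_of_le_ne_top ?_ (Measure.restrict_apply_le _ _)
    simp
  have hm := (hmem 1).1
  have hin : MemInter (AEEqFun.mk φ hm) :=
    ⟨(hmem 1).ae_eq (AEEqFun.coeFn_mk _ _).symm, (hmem ∞).ae_eq (AEEqFun.coeFn_mk _ _).symm⟩
  obtain ⟨C, hC⟩ := hE
  obtain ⟨g, hg, -⟩ := hC ⟨_, E.inter_subset _ hin⟩
  refine ⟨g, ?_⟩
  filter_upwards [hg, ae_restrict_mem measurableSet_Ioi] with t ht (h0 : 0 < t)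
  rw [ht, hardy, intervalIntegral.integral_of_le h0.le]
  have e1 : ∫ s in Ioc 0 t, (AEEqFun.mk φ hm) s = ∫ s in Ioc 0 t, φ s :=
    integral_congr_ae ((AEEqFun.coeFn_mk φ hm).filter_mono
      (ae_mono (Measure.restrict_mono Ioc_subset_Ioi_self le_rfl)))
  have e2 : ∫ s in Ioc 0 t, φ s = ((min t 1 : ℝ) : ℂ) := by
    rw [hφ, setIntegral_indicator measurableSet_Ioc, Ioc_inter_Ioc, setIntegral_const]
    have : 0 ≤ min t 1 := by positivity
    simp [this]
  change (t : ℂ)⁻¹ * ∫ s in Ioc 0 t, (AEEqFun.mk φ hm) s = _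
  rw [e1, e2]
  push_cast
  rfl

end BanachFunctionSpace

/-! ### K-functions and the closure of the domain -/

section KFunction

variable {Y : Type*} [AddCommGroup Y] {N₀ N₁ : Y → ℝ≥0∞}

lemma kFun_monotone (x : Y) : Monotone (kFun N₀ N₁ x) := fun _ _ h =>
  iInf_mono fun _ => by gcongr

lemma kFun_le (x v : Y) (t : ℝ) : kFun N₀ N₁ x t ≤ N₀ (x - v) + ENNReal.ofReal t * N₁ v :=
  iInf_le _ v

end KFunction

section Closure

variable {X : Type*} [NormedAddCommGroup X] {A : Set (X × X)}

lemma setNorm_eq_top {v : X} (hv : v ∉ opDom A) : setNorm A v = ∞ := by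
  simp only [setNorm, iInf_eq_top]
  exact fun f hf => absurd ⟨f, hf⟩ hv

/-- Points with a finite truncated interpolation function lie in the closure of the domain. -/
lemma mem_closure_opDom (E : BanachFunctionSpace) {τ : ℝ} (hτ : 0 < τ) {x : X}
    (hx : truncInterpFun E τ (fun y : X => ‖y‖ₑ) (setNorm A) x < ∞) :
    x ∈ closure (opDom A) := by
  by_contra hcl
  obtain ⟨δ, hδ, hball⟩ := Metric.isOpen_iff.1 isClosed_closure.isOpen_compl x hcl
  obtain ⟨f, hf⟩ := E.extNorm_lt_top_iff.1 hx
  -- Competitors in the domain are at distance at least δ from x; the others cost ∞.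
  have hK (t : ℝ) (ht : 0 < t) :
      ENNReal.ofReal δ ≤ kFun (fun y : X => ‖y‖ₑ) (setNorm A) x t := by
    refine le_iInf fun v => ?_
    by_cases hv : v ∈ opDom A
    · refine le_add_right ?_
      change _ ≤ ‖x - v‖ₑ
      rw [← ofReal_norm]
      refine ENNReal.ofReal_le_ofReal ?_
      by_contra! hlt
      refine hball (a := v) ?_ (subset_closure hv)
      rwa [Metric.mem_ball, dist_comm, dist_eq_norm]
    · rw [setNorm_eq_top hv, ENNReal.mul_top (by simpa using ht)]
      simp
  have hint := (E.subset_sum f f.2).integrableOn τ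
  have hinv : IntegrableOn (fun t : ℝ => t⁻¹) (Ioo 0 τ) := by
    refine Integrable.mono' (g := fun t => δ⁻¹ * ‖(f : ℝ →ₘ[halfLine] ℂ) t‖)
      (hint.norm.const_mul _) measurable_inv.aestronglyMeasurable ?_
    have hf' := hf.filter_mono (ae_mono (Measure.restrict_mono
      (fun _ h => h.1 : Ioo (0 : ℝ) τ ⊆ Ioi 0) (le_refl volume)))
    filter_upwards [hf', ae_restrict_mem measurableSet_Ioo] with t ht hmem
    obtain ⟨h1, h2⟩ := ht
    rw [indicator_of_mem hmem] at h1 h2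
    have ht0 : 0 < t := hmem.1
    rw [h2, Complex.norm_real, Real.norm_of_nonneg ENNReal.toReal_nonneg,
      Real.norm_of_nonneg (inv_pos.2 ht0).le, ← div_eq_inv_mul, le_div_iff₀ hδ]
    refine (ENNReal.ofReal_le_iff_le_toReal h1).1 ?_
    rw [ENNReal.le_div_iff_mul_le (Or.inl (by simpa using ht0)) (Or.inl (by simp)),
      ← ENNReal.ofReal_mul (by positivity)]
    refine le_trans (le_of_eq ?_) (hK t ht0)
    congr 1
    field_simp
  have h3 : IntervalIntegrable (fun t : ℝ => t⁻¹) volume 0 τ := by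
    rw [intervalIntegrable_iff_integrableOn_Ioo_of_le hτ.le]
    exact hinv
  rw [intervalIntegrable_inv_iff] at h3
  rcases h3 with h3 | h3
  · exact hτ.ne h3
  · exact h3 (by simp)

end Closure

end RealInterp

/-! ### Interpolation between C and Lip -/

namespace RealInterp

variable {X : Type*} [NormedAddCommGroup X]

/-- The interpolation norm of `(C, Lip)` is finite as soon as the `K`-function with the Lipschitz
seminorm is dominated near zero by an element of the function space. -/
theorem mem_interpSpaceCLip (E : BanachFunctionSpace) (hE : E.HardyBounded) {T τ C : ℝ}
    (hτ : 0 < τ) (hC : 0 ≤ C) (u : C(Icc (0 : ℝ) T, X)) {k : ℝ → ℝ≥0∞}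
    (hk : E.extNorm ((Ioo 0 τ).indicator fun t => k t / ENNReal.ofReal t) < ∞)
    (h : ∀ t, 0 < t → kFun (fun g : C(Icc (0 : ℝ) T, X) => ‖g‖ₑ) lipSeminorm u t ≤
      ENNReal.ofReal C * k t) :
    u ∈ interpSpaceCLip E T X := by
  obtain ⟨f, hf⟩ := E.extNorm_lt_top_iff.1 hk
  obtain ⟨g, hg⟩ := E.exists_min_one_inv hE
  set N : C(Icc (0 : ℝ) T, X) → ℝ≥0∞ := fun g => ‖g‖ₑ
  -- D is chosen so that t ≤ D min(t,1) for t < τ and 1 ≤ D min(t,1) for t ≥ τ.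
  set D : ℝ := 1 + τ + τ⁻¹ with hD
  -- The full Lipschitz norm adds t‖v‖ to the cost, and ‖v‖ ≤ ‖u - v‖ + ‖u‖ with t < τ.
  have hsmall (t : ℝ) (ht : 0 < t) (htτ : t < τ) : kFun N lipNorm u t ≤
      ENNReal.ofReal (1 + τ) * (ENNReal.ofReal C * k t) + ENNReal.ofReal t * ‖u‖ₑ := by
    refine le_trans ?_ (add_le_add_left (mul_le_mul_right (h t ht) _) _)
    rw [kFun, kFun, ENNReal.mul_iInf_of_ne (by simp; linarith) ENNReal.ofReal_ne_top,
      ENNReal.iInf_add]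
    refine iInf_mono fun v => ?_
    have hv : ‖v‖ₑ ≤ ‖u - v‖ₑ + ‖u‖ₑ := by
      rw [add_comm]; simpa using enorm_sub_le (a := u) (b := u - v)
    have ht1 : ENNReal.ofReal t ≤ ENNReal.ofReal τ := ENNReal.ofReal_le_ofReal htτ.le
    have e : ENNReal.ofReal (1 + τ) = 1 + ENNReal.ofReal τ := by
      rw [ENNReal.ofReal_add zero_le_one hτ.le, ENNReal.ofReal_one]
    calc N (u - v) + ENNReal.ofReal t * lipNorm v
        ≤ ‖u - v‖ₑ + ENNReal.ofReal t * ((‖u - v‖ₑ + ‖u‖ₑ) + lipSeminorm v) := by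
          unfold lipNorm; gcongr
      _ = ‖u - v‖ₑ + ENNReal.ofReal t * ‖u - v‖ₑ + ENNReal.ofReal t * lipSeminorm v
          + ENNReal.ofReal t * ‖u‖ₑ := by ring
      _ ≤ (‖u - v‖ₑ + ENNReal.ofReal τ * ‖u - v‖ₑ + (1 + ENNReal.ofReal τ) *
          (ENNReal.ofReal t * lipSeminorm v)) + ENNReal.ofReal t * ‖u‖ₑ := by
          refine add_le_add_left (add_le_add (by gcongr) ?_) _
          rw [add_mul, one_mul]
          exact le_self_add
      _ = _ := by rw [e]; ring
  have hlarge (t : ℝ) : kFun N lipNorm u t ≤ ‖u‖ₑ := by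
    have h0 : lipNorm (0 : C(Icc (0 : ℝ) T, X)) = 0 := by
      have : lipSeminorm (0 : C(Icc (0 : ℝ) T, X)) ≤ ((0 : ℝ≥0) : ℝ≥0∞) :=
        iInf₂_le (0 : ℝ≥0) (LipschitzWith.const 0)
      rw [lipNorm, ← ofReal_norm, norm_zero]
      simpa using this
    simpa [h0, N] using kFun_le (N₀ := N) (N₁ := lipNorm) u 0 t
  refine E.extNorm_lt_top_of_le
    ((kFun_monotone u).measurable.div ENNReal.measurable_ofReal)
    ((((1 + τ) * C : ℝ) : ℂ) • f + ((D * ‖u‖ : ℝ) : ℂ) • g) ?_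
  filter_upwards [hf, hg, ae_restrict_mem measurableSet_Ioi,
    AEEqFun.coeFn_add ((((1 + τ) * C : ℝ) : ℂ) • (f : ℝ →ₘ[halfLine] ℂ))
      (((D * ‖u‖ : ℝ) : ℂ) • (g : ℝ →ₘ[halfLine] ℂ)),
    AEEqFun.coeFn_smul (((1 + τ) * C : ℝ) : ℂ) (f : ℝ →ₘ[halfLine] ℂ),
    AEEqFun.coeFn_smul ((D * ‖u‖ : ℝ) : ℂ) (g : ℝ →ₘ[halfLine] ℂ)]
    with t hft hgt (ht : 0 < t) e₁ e₂ e₃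
  obtain ⟨hfin, hft⟩ := hft
  set κ := (Ioo 0 τ).indicator (fun t => k t / ENNReal.ofReal t) t with hκ
  have hD0 : 0 < D := by positivity
  have hnorm : ‖((((((1 + τ) * C : ℝ) : ℂ) • f + ((D * ‖u‖ : ℝ) : ℂ) • g : E.carrier) :
      ℝ →ₘ[halfLine] ℂ)) t‖ₑ =
      ENNReal.ofReal (1 + τ) * ENNReal.ofReal C * κ +
        ENNReal.ofReal (D * (t⁻¹ * min t 1)) * ‖u‖ₑ := by
    rw [Submodule.coe_add, Submodule.coe_smul, Submodule.coe_smul, e₁, Pi.add_apply, e₂, e₃,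
      Pi.smul_apply, Pi.smul_apply, hft, hgt, smul_eq_mul, smul_eq_mul, ← Complex.ofReal_mul,
      ← Complex.ofReal_mul, ← Complex.ofReal_add, ← ofReal_norm, Complex.norm_real,
      Real.norm_of_nonneg (by positivity), ENNReal.ofReal_add (by positivity) (by positivity),
      ENNReal.ofReal_mul (by positivity), ENNReal.ofReal_mul (by positivity),
      ENNReal.ofReal_toReal hfin, ← ofReal_norm u,
      ← ENNReal.ofReal_mul (p := D * (t⁻¹ * min t 1)) (by positivity)]
    congr 2
    ring
  rw [hnorm]
  have htne : ENNReal.ofReal t ≠ 0 := by simpa using ht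
  rw [ENNReal.div_le_iff htne ENNReal.ofReal_ne_top, add_mul, mul_right_comm _ ‖u‖ₑ,
    ← ENNReal.ofReal_mul (p := D * (t⁻¹ * min t 1)) (by positivity)]
  have hDt : D * (t⁻¹ * min t 1) * t = D * min t 1 := by field_simp
  rw [hDt]
  by_cases htτ : t < τ
  · refine (hsmall t ht htτ).trans (add_le_add (le_of_eq ?_) ?_)
    · rw [hκ, indicator_of_mem (show t ∈ Ioo 0 τ from ⟨ht, htτ⟩), mul_assoc (_ * _),
        ENNReal.div_mul_cancel htne ENNReal.ofReal_ne_top, mul_assoc]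
    · gcongr
      have : 0 < τ⁻¹ := inv_pos.2 hτ
      rcases min_cases t 1 with ⟨e, -⟩ | ⟨e, -⟩ <;> rw [e] <;> nlinarith
  · refine (hlarge t).trans (le_add_left (le_mul_of_one_le_left zero_le ?_))
    rw [ENNReal.one_le_ofReal]
    push Not at htτ
    have h1 : τ⁻¹ * τ = 1 := inv_mul_cancel₀ hτ.ne'
    have : 0 < τ⁻¹ := inv_pos.2 hτ
    rcases min_cases t 1 with ⟨e, -⟩ | ⟨e, -⟩ <;> rw [e] <;> nlinarith

variable [NormedSpace ℝ X] {A : Set (X × X)}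

/-- The restriction of a mild solution to `[0,T]`. -/
def IsMildSolution.restrict {x : X} {u : ℝ → X} (h : IsMildSolution A x u) (T : ℝ) :
    C(Icc (0 : ℝ) T, X) where
  toFun t := u t
  continuous_toFun := (h.1.mono fun _ ht => ht.1).domRestrict

/-- The `K`-function of an orbit is dominated by the `K`-function of its initial value. -/
theorem kFun_restrict_le {ω : ℝ} (hω : 0 ≤ ω) (hA : IsAccretive ω A) {S : ℝ → X → X}
    (hS : IsGeneratedSemigroup A S) {x : X} (hx : x ∈ closure (opDom A)) (T : ℝ) {t : ℝ}
    (ht : 0 < t) :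
    kFun (fun g : C(Icc (0 : ℝ) T, X) => ‖g‖ₑ) lipSeminorm ((hS x hx).restrict T) t ≤
      ENNReal.ofReal (Real.exp (ω * T)) * kFun (fun y : X => ‖y‖ₑ) (setNorm A) x t := by
  have hc : 0 < Real.exp (ω * T) := Real.exp_pos _
  rw [kFun.eq_def (fun y : X => ‖y‖ₑ),
    ENNReal.mul_iInf_of_ne (by simpa using hc) ENNReal.ofReal_ne_top]
  refine le_iInf fun v => ?_
  by_cases hv : v ∈ opDom A
  swap
  · rw [setNorm_eq_top hv, ENNReal.mul_top (by simpa using ht), add_top,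
      ENNReal.mul_top (by simpa using hc)]
    exact le_top
  have hvc : v ∈ closure (opDom A) := subset_closure hv
  -- The orbit of v is the competitor for the orbit of x.
  set w := (hS v hvc).restrict T with hw
  have h1 : ‖(hS x hx).restrict T - w‖ₑ ≤ ENNReal.ofReal (Real.exp (ω * T)) * ‖x - v‖ₑ := by
    rw [← ofReal_norm, ← ofReal_norm, ← ENNReal.ofReal_mul hc.le]
    refine ENNReal.ofReal_le_ofReal ((ContinuousMap.norm_le _ (by positivity)).2 fun s => ?_)
    refine ((hS x hx).norm_sub_le (hS v hvc) hω hA hx s.2.1).trans ?_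
    have := s.2.2
    gcongr
  have h2 : lipSeminorm w ≤ ENNReal.ofReal (Real.exp (ω * T)) * setNorm A v := by
    rw [setNorm, ENNReal.mul_iInf_of_ne (by simpa using hc) ENNReal.ofReal_ne_top]
    refine le_iInf fun f => ?_
    rw [ENNReal.mul_iInf_of_ne (by simpa using hc) ENNReal.ofReal_ne_top]
    refine le_iInf fun hf => ?_
    rw [← ofReal_norm, ← ENNReal.ofReal_mul hc.le]
    refine iInf₂_le (Real.toNNReal (Real.exp (ω * T) * ‖f‖))
      (LipschitzWith.of_dist_le_mul fun s r => ?_)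
    rw [Real.coe_toNNReal _ (by positivity), dist_eq_norm, Subtype.dist_eq, Real.dist_eq,
      mul_assoc]
    exact (hS v hvc).norm_sub_le_mul hω hA hf s.2.1 r.2.1 s.2.2 r.2.2
  refine (kFun_le _ w t).trans ?_
  rw [mul_add, mul_left_comm]
  gcongr

end RealInterp

theorem mainTheorem6 {X : Type*} [NormedAddCommGroup X] [NormedSpace ℝ X] [CompleteSpace X]
    (ω : ℝ) (hω : 0 ≤ ω) (A : Set (X × X)) (hA : RealInterp.IsMAccretive ω A)
    (S : ℝ → X → X) (hS : RealInterp.IsGeneratedSemigroup A S)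
    (E : RealInterp.BanachFunctionSpace) (hE : E.HardyBounded)
    (τ : ℝ) (hτ : 0 < τ) (x : X)
    (hx : x ∈ RealInterp.effDom
      (RealInterp.truncInterpFun E τ (fun y : X => ‖y‖ₑ) (RealInterp.setNorm A)))
    (T : ℝ) (hT : 0 ≤ T) :
    x ∈ closure (RealInterp.opDom A) ∧
    ∃ u : C(Set.Icc (0 : ℝ) T, X),
      (∀ t : Set.Icc (0 : ℝ) T, u t = S t x) ∧
      u ∈ RealInterp.interpSpaceCLip E T X ∧
      ∀ t : ℝ, 0 < t →
        RealInterp.kFun (fun g : C(Set.Icc (0 : ℝ) T, X) => ‖g‖ₑ) RealInterp.lipSeminorm u t ≤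
          ENNReal.ofReal (Real.exp (ω * T)) *
            RealInterp.kFun (fun y : X => ‖y‖ₑ) (RealInterp.setNorm A) x t := by
  have hcl := RealInterp.mem_closure_opDom E hτ hx
  have hK := fun {t : ℝ} => RealInterp.kFun_restrict_le hω hA.1 hS hcl T (t := t)
  exact ⟨hcl, (hS x hcl).restrict T, fun _ => rfl,
    RealInterp.mem_interpSpaceCLip E hE hτ (Real.exp_pos _).le _ hx fun t ht => hK ht,
    fun t ht => hK ht⟩
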